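/- **Expansion of $q$-Whittaker polynomials into inhomogeneous $q$-Whittaker polynomials.** Let $q$ be an indeterminate, $(a;q)_k=\prod_{i=0}^{k-1}(1-aq^i)$ and $\binom{a}{b}_q=\frac{(q;q)_a}{(q;q)_{a-b}(q;q)_b}$ for $0\le b\le a$. All partitions below have at most $n$ parts, and $m_i(\lambda')$ is the number of columns of size $i$ in the Young diagram of $\lambda$. A lattice model is a rectangular array of vertices whose edges are labelled by non-negative integers. A vertex with bottom, left, top and right labels $a,b,c,d$ has a weight that vanishes unless $a+b=c+d$. The partition function is the sum, over all labellings of the edges with the given boundary labels, of the product of the vertex weights. * The $q$-Whittaker polynomial $W_\lambda(x_1,\dots,x_n)\in\mathbb{Q}(q)[x_1,\dots,x_n]$ is given by the branching formula (a sum over Gelfand–Tsetlin patterns) $$W_\lambda(x_1,\dots,x_n)=\sum_{\mu}x_n^{|\lambda|-|\mu|}\prod_{i=1}^{n-1}\binom{\lambda_i-\lambda_{i+1}}{\lambda_i-\mu_i}_q\,W_\mu(x_1,\dots,x_{n-1}),$$ where the sum is over all $\mu=(\mu_1,\dots,\mu_{n-1})$ with $\lambda_{i+1}\le\mu_i\le\lambda_i$,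 and $W=1$ in zero variables. * The inhomogeneous $q$-Whittaker polynomial $\mathbb{F}_\lambda(x_1,\dots,x_n)$ is the partition function of the lattice with rows carrying $x_n,\dots,x_1$ from bottom to top, bottom labels $\dots,m_2(\lambda'),m_1(\lambda')$ from left to right, left and top labels $0$, free right boundary, and vertex weights $\mathbf 1_{a+b=c+d}\,\mathbf 1_{b\le c}\,x^d\,(x;q)_{c-b}\binom{a}{c-b}_q$. * The coefficient $a_{\lambda,\mu}(q)$ is the partition function of the $n\times n$ lattice with bottom labels $m_n(\lambda'),\dots,m_1(\lambda')$ from left to right, right labels $m_1(\mu'),\dots,m_n(\mu')$ from bottom to top, left and top labels $0$, and vertex weights $\mathbf 1_{a+b=c+d}\,\mathbf 1_{b\le c}\binom{a}{c-b}_q$. Let $n$ be a positive integer and $\lambda$ a partition with at most $n$ parts. Then $a_{\lambda,\mu}(q)\neq0$ for only finitely many partitions $\mu$ with at most $n$ parts, and $$W_\lambda(x_1,\dots,x_n)=\sum_{\mu}a_{\lambda,\mu}(q)\,\mathbb{F}_\mu(x_1,\dots,x_n),$$ the sum being over all partitions $\mu$ with at most $n$ parts. Moreover $a_{\lambda,\mu}(q)\in\mathbb{N}[q]$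 for every such $\mu$, so the $q$-Whittaker polynomials expand positively in the inhomogeneous $q$-Whittaker polynomials. -/

import Mathlib

open Finset

noncomputable section

namespace QW

/-- The field `ℚ(q)` of rational functions in the indeterminate `q`. -/
abbrev Kq : Type := RatFunc ℚ

/-- The indeterminate `q`. -/
def q : Kq := RatFunc.X

/-- The `q`-Pochhammer symbol `(a; q)_k = (1 - a)(1 - a q) ⋯ (1 - a q^(k-1))`. -/
def qPochhammer {R : Type*} [CommRing R] (q a : R) (k : ℕ) : R :=
  ∏ i ∈ range k, (1 - a * q ^ i)

/-- The `q`-binomial coefficient `(q; q)_a / ((q; q)_(a-b) (q; q)_b)`,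
zero unless `b ≤ a`. -/
def qBinom (a b : ℕ) : Kq :=
  if b ≤ a then qPochhammer q q a / (qPochhammer q q (a - b) * qPochhammer q q b) else 0

/-! Partitions are Young diagrams: row `i` (counted from `0`) of `lam` has length
`lam.rowLen i`, and `lam.colLen 0` is the number of nonzero parts. -/

/-- `m_i(λ')`, the number of parts of the conjugate partition that are equal to `i`,
i.e. the number of columns of size `i` of `λ`. -/
def colMult (lam : YoungDiagram) (i : ℕ) : ℕ :=
  lam.transpose.rowLens.count i

/-- The partition function of a rectangular lattice with `M` rows, numbered from bottom to top,
and `N` columns, numbered from left to right.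

A configuration labels every edge by a natural number: `v i j` is the label of the vertical edge
below the vertex in row `i` and column `j` (and `v (i+1) j` is the label of the edge above it),
`h i j` is the label of the horizontal edge to its left (and `h i (j+1)` of the edge to its right).
The weight of a configuration is the product over all vertices of
`w i j (bottom label) (left label) (top label) (right label)`, and the partition function
is the sum of the weights of all configurations with the prescribed labels on the
bottom, left and top boundaries, whose label on the right boundary edge of row `i` lies
in `right i` (a single label, or all of `ℕ` for a free edge).

The weights are supposed to obey the conservation law, i.e. to vanish unless
`bottom + left = top + right`. Then no label of a configuration of nonzero weight exceeds the
number of particles that enter from the bottom and from the left, so that the sum runs over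
labels up to this number only. -/
def partitionFunction {R : Type*} [CommSemiring R] (M N : ℕ)
    (w : Fin M → Fin N → ℕ → ℕ → ℕ → ℕ → R)
    (bottom : Fin N → ℕ) (left : Fin M → ℕ) (top : Fin N → ℕ) (right : Fin M → Set ℕ) : R :=
  open Classical in
  ∑ v : Fin (M + 1) → Fin N → Fin ((∑ j, bottom j) + (∑ i, left i) + 1),
    ∑ h : Fin M → Fin (N + 1) → Fin ((∑ j, bottom j) + (∑ i, left i) + 1),
      if (∀ j, (v 0 j : ℕ) = bottom j) ∧ (∀ i, (h i 0 : ℕ) = left i) ∧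
          (∀ j, (v (Fin.last M) j : ℕ) = top j) ∧ (∀ i, (h i (Fin.last N) : ℕ) ∈ right i)
      then ∏ i : Fin M, ∏ j : Fin N,
        w i j (v i.castSucc j) (h i j.castSucc) (v i.succ j) (h i j.succ)
      else 0

/-- The Boltzmann weight
`1_{a + b = c + d} 1_{b ≤ c} x^d (x; q)_(c-b) [a choose c-b]_q` of the inhomogeneous
`q`-Whittaker polynomials; the labels are `a` (bottom), `b` (left), `c` (top), `d` (right). -/
def inhomWeight {n : ℕ} (x : MvPolynomial (Fin n) Kq) (a b c d : ℕ) : MvPolynomial (Fin n) Kq :=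
  if a + b = c + d ∧ b ≤ c then
    x ^ d * qPochhammer (MvPolynomial.C q) x (c - b) * MvPolynomial.C (qBinom a (c - b))
  else 0

/-- The inhomogeneous `q`-Whittaker polynomial `𝔽_λ(x_1, …, x_n)`: the lattice has rows with
variables `x_n, …, x_1` from bottom to top, and its columns, from left to right, are the sites
`N, …, 2, 1`; site `i` has `m_i(λ')` particles entering from the bottom and none leaving at the
top, nothing enters from the left, and the right boundary is free. All sites `i > N`
would be empty, since `N` is at least the number of parts of `λ`. -/
def inhomQWhittaker (n : ℕ) (lam : YoungDiagram) : MvPolynomial (Fin n) Kq :=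
  let N := max n (lam.colLen 0)
  partitionFunction n N (fun i _ => inhomWeight (MvPolynomial.X i.rev))
    (fun j => colMult lam (N - (j : ℕ))) (fun _ => 0) (fun _ => 0) (fun _ => Set.univ)

/-- The sum over Gelfand–Tsetlin patterns with top row `l = (l_1 ≥ ⋯ ≥ l_n)` which defines the
`q`-Whittaker polynomial, written as a recursion (the branching formula): the variable
`x_{n+1}` is split off by summing over all `m` with `l_{i+1} ≤ m_i ≤ l_i`, with coefficient
`∏_{i ≤ n} (q;q)_{l_i - l_{i+1}} / ((q;q)_{l_i - m_i} (q;q)_{m_i - l_{i+1}})`. -/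
def gelfandTsetlinSum : (n : ℕ) → (Fin n → ℕ) → MvPolynomial (Fin n) Kq
  | 0, _ => 1
  | n + 1, l =>
    ∑ m ∈ Fintype.piFinset (fun i : Fin n => Finset.Icc (l i.succ) (l i.castSucc)),
      MvPolynomial.C (∏ i : Fin n, qBinom (l i.castSucc - l i.succ) (l i.castSucc - m i)) *
        MvPolynomial.X (Fin.last n) ^ ((∑ i, l i) - (∑ i, m i)) *
        MvPolynomial.rename Fin.castSucc (gelfandTsetlinSum n m)

/-- The `q`-Whittaker polynomial `W_λ(x_1, …, x_n; q)`, zero if `λ` has more than `n` parts. -/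
def qWhittaker (n : ℕ) (lam : YoungDiagram) : MvPolynomial (Fin n) Kq :=
  if lam.colLen 0 ≤ n then gelfandTsetlinSum n (fun i => lam.rowLen (i : ℕ)) else 0

/-- The vertex weight `1_{a + b = c + d} 1_{b ≤ c} [a choose c-b]_q`; the labels are
`a` (bottom), `b` (left), `c` (top), `d` (right). -/
def transitionWeight (a b c d : ℕ) : Kq :=
  if a + b = c + d ∧ b ≤ c then qBinom a (c - b) else 0

/-- The coefficient `a_{λ,μ}(q)`: the partition function of the `n × n` lattice whose bottom
boundary is `m_n(λ'), …, m_1(λ')` from left to right, whose right boundary is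
`m_1(μ'), …, m_n(μ')` from bottom to top, and whose left and top boundaries are `0`. -/
def transitionCoeff (n : ℕ) (lam mu : YoungDiagram) : Kq :=
  partitionFunction n n (fun _ _ => transitionWeight)
    (fun j => colMult lam (n - (j : ℕ))) (fun _ => 0) (fun _ => 0)
    (fun i => {colMult mu ((i : ℕ) + 1)})

end QW

end

/-! The polynomials `W_λ` and `𝔽_μ` and the coefficients `a_{λ,μ}` are partition functions of the
same kind of lattice. They differ only in the weight of a vertex at which `d` particles turn right
and `e` go up: `whitWeight x` for `W_λ`, `inhWeight x` for `𝔽_μ`, `whitWeight 1` for `a_{λ,μ}`. For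
`W_λ` this is a reading of Gelfand–Tsetlin patterns: of the `λ_i - λ_{i+1}` particles in a column,
`λ_i - μ_i` turn right (`sum_interlacing_eq_rowOp`).

A particle that turns right must go up in the next column, so it advances by at most one column per
row. With as many rows as columns and an empty top, every row therefore has to empty the leftmost
remaining column, and each row acts as a `shrinkOp`.

The sum over `μ` glues the lattice of `𝔽_μ` to the right boundary of the lattice of `a_{λ,μ}`. A
relation of Yang–Baxter type (`exchange`, `rowOp_exchange`) pulls an inhomogeneous vertex leftwards
through two rows with parameters `1` and `x`, swapping the parameters; at the left boundary the
vertex is absorbed (`sum_whitWeight_one_mul`). One inhomogeneous row thus becomes a q-Whittaker row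
below a smaller expansion lattice (`expansionOp_shrinkOp`), and iteration gives the identity
(`expansionOp_shrinkIter`).

Finiteness is conservation of particles, and positivity holds because Gaussian binomials lie in
`ℕ[q]`. -/

noncomputable section

namespace QW

/-! ### Gaussian binomials -/

/-- The Gaussian binomial `(q; q)_(d+e) / ((q; q)_d (q; q)_e)`. -/
def gaussBinom (d e : ℕ) : Kq := qBinom (d + e) e

theorem one_sub_q_pow_ne_zero (k : ℕ) : (1 : Kq) - q ^ (k + 1) ≠ 0 := by
  have h : (1 : Kq) - q ^ (k + 1) =
      algebraMap (Polynomial ℚ) Kq (1 - Polynomial.X ^ (k + 1)) := by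
    simp [q, RatFunc.algebraMap_X]
  rw [h]
  refine (map_ne_zero_iff _ (IsFractionRing.injective (Polynomial ℚ) Kq)).2 fun h0 => ?_
  have := congrArg (Polynomial.eval 0) h0
  simp at this

theorem qPochhammer_zero {R : Type*} [CommRing R] (y a : R) : qPochhammer y a 0 = 1 := by
  simp [qPochhammer]

theorem qPochhammer_succ {R : Type*} [CommRing R] (y a : R) (k : ℕ) :
    qPochhammer y a (k + 1) = qPochhammer y a k * (1 - a * y ^ k) := by
  simp [qPochhammer, prod_range_succ]

theorem qPochhammer_q_ne_zero (k : ℕ) : qPochhammer q q k ≠ 0 := by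
  rw [qPochhammer, prod_ne_zero_iff]
  intro i _
  rw [← pow_succ']
  exact one_sub_q_pow_ne_zero i

theorem gaussBinom_eq (d e : ℕ) :
    gaussBinom d e = qPochhammer q q (d + e) / (qPochhammer q q d * qPochhammer q q e) := by
  simp [gaussBinom, qBinom]

theorem qBinom_left (d e : ℕ) : qBinom (d + e) d = gaussBinom d e := by
  rw [gaussBinom_eq, qBinom, if_pos (by omega), Nat.add_sub_cancel_left, mul_comm]

theorem gaussBinom_comm (d e : ℕ) : gaussBinom d e = gaussBinom e d := by
  rw [gaussBinom_eq, gaussBinom_eq, add_comm, mul_comm (qPochhammer q q d)]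

theorem gaussBinom_zero_left (e : ℕ) : gaussBinom 0 e = 1 := by
  rw [gaussBinom_eq, zero_add, qPochhammer_zero, one_mul, div_self (qPochhammer_q_ne_zero e)]

theorem gaussBinom_zero_right (d : ℕ) : gaussBinom d 0 = 1 := by
  rw [gaussBinom_eq, add_zero, qPochhammer_zero, mul_one, div_self (qPochhammer_q_ne_zero d)]

/-- This form of the q-Pascal rule drives both the exchange relation and positivity: its
coefficients `1` and `q ^ (e + 1)` involve no signs. -/
theorem gaussBinom_succ_succ (d e : ℕ) :
    gaussBinom (d + 1) (e + 1) =
      gaussBinom (d + 1) e + q ^ (e + 1) * gaussBinom d (e + 1) := by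
  simp only [gaussBinom_eq, ← add_assoc, add_right_comm d 1 e, qPochhammer_succ]
  have h1 := qPochhammer_q_ne_zero d
  have h2 := qPochhammer_q_ne_zero e
  have h3 := one_sub_q_pow_ne_zero d
  have h4 := one_sub_q_pow_ne_zero e
  rw [pow_succ'] at h3 h4
  field_simp
  ring

/-- Both sides are the q-trinomial coefficient of `r`, `u`, `e`. -/
theorem gaussBinom_mul_gaussBinom (r u e : ℕ) :
    gaussBinom (r + u) e * gaussBinom r u = gaussBinom r (u + e) * gaussBinom u e := by
  simp only [gaussBinom_eq]
  have := qPochhammer_q_ne_zero (r + u)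
  have := qPochhammer_q_ne_zero (u + e)
  have := qPochhammer_q_ne_zero r
  have := qPochhammer_q_ne_zero u
  have := qPochhammer_q_ne_zero e
  field_simp
  rw [add_assoc]

/-! ### Sums over antidiagonals -/

section Antidiagonal

variable {R : Type*} [CommRing R]

theorem sum_antidiagonal_assoc {M : Type*} [AddCommMonoid M] (n : ℕ) (X : ℕ → ℕ → ℕ → M) :
    ∑ p ∈ antidiagonal n, ∑ s ∈ antidiagonal p.1, X s.1 s.2 p.2 =
      ∑ p ∈ antidiagonal n, ∑ s ∈ antidiagonal p.2, X p.1 s.1 s.2 := by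
  rw [sum_sigma', sum_sigma']
  refine sum_nbij' (fun t => ⟨(t.2.1, t.2.2 + t.1.2), (t.2.2, t.1.2)⟩)
    (fun t => ⟨(t.1.1 + t.2.1, t.2.2), (t.1.1, t.2.1)⟩) ?_ ?_ ?_ ?_ ?_
  · rintro ⟨⟨a, b⟩, ⟨c, d⟩⟩ h
    simp only [mem_sigma, HasAntidiagonal.mem_antidiagonal, and_true] at h ⊢
    omega
  · rintro ⟨⟨a, b⟩, ⟨c, d⟩⟩ h
    simp only [mem_sigma, HasAntidiagonal.mem_antidiagonal, and_true] at h ⊢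
    omega
  · rintro ⟨⟨a, b⟩, ⟨c, d⟩⟩ h
    simp only [mem_sigma, HasAntidiagonal.mem_antidiagonal] at h
    obtain ⟨-, rfl⟩ := h
    rfl
  · rintro ⟨⟨a, b⟩, ⟨c, d⟩⟩ h
    simp only [mem_sigma, HasAntidiagonal.mem_antidiagonal] at h
    obtain ⟨-, rfl⟩ := h
    rfl
  · rintro ⟨⟨a, b⟩, ⟨c, d⟩⟩ _
    rfl

/-- Summation of a weight that obeys a Pascal-type recursion with coefficients `α`, `β`. -/
theorem sum_antidiagonal_succ_of_pascal (g : ℕ → ℕ → R) (α β : ℕ → R)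
    (h : ∀ i j, g (i + 1) (j + 1) = α j * g (i + 1) j + β (j + 1) * g i (j + 1))
    (h0 : ∀ j, g 0 (j + 1) = α j * g 0 j) (h1 : ∀ i, g (i + 1) 0 = β 0 * g i 0)
    (H : ℕ → ℕ → R) (n : ℕ) :
    ∑ p ∈ antidiagonal (n + 1), g p.1 p.2 * H p.1 p.2 =
      ∑ p ∈ antidiagonal n, g p.1 p.2 * (α p.2 * H p.1 (p.2 + 1) + β p.2 * H (p.1 + 1) p.2) := by
  -- The two Pascal contributions, extended by zero to the edges, so that each shifted sum loses
  -- only a zero boundary term.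
  let A : ℕ → ℕ → R := fun i j => Nat.casesOn j 0 fun j' => α j' * g i j'
  let B : ℕ → ℕ → R := fun i j => Nat.casesOn i 0 fun i' => β j * g i' j
  have hg : ∀ p ∈ antidiagonal (n + 1), g p.1 p.2 * H p.1 p.2 =
      A p.1 p.2 * H p.1 p.2 + B p.1 p.2 * H p.1 p.2 := by
    rintro ⟨i, j⟩ hp
    rw [HasAntidiagonal.mem_antidiagonal] at hp
    rcases i with _ | i <;> rcases j with _ | j
    · simp at hp
    · simp [A, B, h0]
    · simp [A, B, h1]
    · simp only [A, B, h]
      ring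
  rw [sum_congr rfl hg, sum_add_distrib, Nat.sum_antidiagonal_succ',
    Nat.sum_antidiagonal_succ (f := fun p => B p.1 p.2 * H p.1 p.2)]
  have hA : A (n + 1) 0 = 0 := rfl
  have hB : B 0 (n + 1) = 0 := rfl
  simp only [hA, hB, zero_mul, zero_add, ← sum_add_distrib, A, B]
  exact sum_congr rfl fun p _ => by ring

end Antidiagonal

/-! ### Vertex weights -/

section Weights

variable {R : Type*} [CommRing R] [Algebra Kq R]

/-- The `q`-Whittaker weight of a vertex at which `d` particles turn right and `e` go up. -/
def whitWeight (x : R) (d e : ℕ) : R := algebraMap Kq R (gaussBinom d e) * x ^ d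

/-- The inhomogeneous `q`-Whittaker weight of a vertex at which `d` particles turn right and
`e` go up. -/
def inhWeight (x : R) (d e : ℕ) : R :=
  whitWeight x d e * qPochhammer (algebraMap Kq R q) x e

theorem whitWeight_zero_right (x : R) (d : ℕ) : whitWeight x d 0 = x ^ d := by
  simp [whitWeight, gaussBinom_zero_right]

theorem inhWeight_zero_right (x : R) (d : ℕ) : inhWeight x d 0 = x ^ d := by
  simp [inhWeight, whitWeight_zero_right, qPochhammer_zero]

theorem whitWeight_succ_succ (x : R) (i j : ℕ) :
    whitWeight x (i + 1) (j + 1) =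
      1 * whitWeight x (i + 1) j +
        (x * algebraMap Kq R q ^ (j + 1)) * whitWeight x i (j + 1) := by
  simp only [whitWeight, gaussBinom_succ_succ, map_add, map_mul, map_pow]
  ring

theorem inhWeight_succ_succ (x : R) (i j : ℕ) :
    inhWeight x (i + 1) (j + 1) =
      (1 - x * algebraMap Kq R q ^ j) * inhWeight x (i + 1) j +
        (x * algebraMap Kq R q ^ (j + 1)) * inhWeight x i (j + 1) := by
  simp only [inhWeight, whitWeight_succ_succ, qPochhammer_succ]
  ring

/-- The Pascal rule as an action on the test function: one extra particle goes up with factor `1` or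
turns right with factor `x q^e`. -/
theorem sum_whitWeight_succ (x : R) (H : ℕ → ℕ → R) (n : ℕ) :
    ∑ p ∈ antidiagonal (n + 1), whitWeight x p.1 p.2 * H p.1 p.2 =
      ∑ p ∈ antidiagonal n, whitWeight x p.1 p.2 *
        (H p.1 (p.2 + 1) + x * algebraMap Kq R q ^ p.2 * H (p.1 + 1) p.2) := by
  rw [sum_antidiagonal_succ_of_pascal (whitWeight x) (fun _ => 1)
    (fun j => x * algebraMap Kq R q ^ j) (whitWeight_succ_succ x)
    (fun j => by simp [whitWeight, gaussBinom_zero_left])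
    (fun i => by simp [whitWeight_zero_right, pow_succ'])]
  simp only [one_mul]

theorem sum_inhWeight_succ (x : R) (H : ℕ → ℕ → R) (n : ℕ) :
    ∑ p ∈ antidiagonal (n + 1), inhWeight x p.1 p.2 * H p.1 p.2 =
      ∑ p ∈ antidiagonal n, inhWeight x p.1 p.2 *
        ((1 - x * algebraMap Kq R q ^ p.2) * H p.1 (p.2 + 1) +
          x * algebraMap Kq R q ^ p.2 * H (p.1 + 1) p.2) :=
  sum_antidiagonal_succ_of_pascal (inhWeight x) (fun j => 1 - x * algebraMap Kq R q ^ j)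
    (fun j => x * algebraMap Kq R q ^ j) (inhWeight_succ_succ x)
    (fun j => by
      simp only [inhWeight, whitWeight, gaussBinom_zero_left, qPochhammer_succ, map_one]; ring)
    (fun i => by simp [inhWeight_zero_right, pow_succ']) H n

/-- The inhomogeneous weights are stochastic: the two factors for an extra particle, `1 - x q^e` and
`x q^e`, add up to `1`. -/
theorem sum_inhWeight (x : R) (n : ℕ) :
    ∑ p ∈ antidiagonal n, inhWeight x p.1 p.2 = 1 := by
  induction n with
  | zero => simp [inhWeight_zero_right]
  | succ n ih =>
    have h := sum_inhWeight_succ x (fun _ _ => 1) n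
    simp only [mul_one, sub_add_cancel] at h
    rw [h, ih]

/-- The local exchange relation after the particles that turn right in both rows have been
factored out. -/
theorem exchange_reduced (x : R) (A P : ℕ) (H : ℕ → ℕ → R) :
    ∑ a ∈ antidiagonal A, inhWeight x 0 a.1 * (algebraMap Kq R (gaussBinom a.1 a.2) *
        ∑ b ∈ antidiagonal (a.2 + P), whitWeight x b.1 b.2 * H (b.1 + a.1) b.2) =
      ∑ b ∈ antidiagonal P, inhWeight x b.1 b.2 *
        ∑ c ∈ antidiagonal (A + b.1), whitWeight 1 c.1 c.2 * H c.1 (c.2 + b.2) := by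
  induction P generalizing H with
  | zero =>
    -- Stochasticity inserts a factor `1` as a sum over splittings of `c.1`; both sides then become
    -- sums over triples, compared by the q-trinomial identity.
    have hR : ∑ c ∈ antidiagonal A, whitWeight 1 c.1 c.2 * H c.1 c.2 =
        ∑ c ∈ antidiagonal A, ∑ b ∈ antidiagonal c.1,
          inhWeight x b.2 b.1 * (whitWeight 1 (b.1 + b.2) c.2 * H (b.1 + b.2) c.2) := by
      refine sum_congr rfl fun c _ => ?_
      rw [← one_mul (_ * _), ← sum_inhWeight x c.1, ← Nat.sum_antidiagonal_swap, sum_mul]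
      refine sum_congr rfl fun b hb => ?_
      rw [HasAntidiagonal.mem_antidiagonal.1 hb, Prod.fst_swap, Prod.snd_swap]
    rw [Nat.antidiagonal_zero, sum_singleton]
    simp only [add_zero, inhWeight_zero_right, pow_zero, one_mul]
    rw [hR, sum_antidiagonal_assoc A (fun u d e => inhWeight x d u *
      (whitWeight 1 (u + d) e * H (u + d) e))]
    simp only [mul_sum]
    refine sum_congr rfl fun a _ => sum_congr rfl fun b hb => ?_
    rw [← HasAntidiagonal.mem_antidiagonal.1 hb, add_comm b.1 a.1]
    have h := congrArg (algebraMap Kq R) (gaussBinom_mul_gaussBinom a.1 b.1 b.2)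
    simp only [map_mul] at h
    simp only [inhWeight, whitWeight, gaussBinom_zero_left, gaussBinom_comm b.1 a.1, map_one,
      one_mul, pow_zero, one_pow, mul_one]
    linear_combination -(x ^ b.1 * qPochhammer (algebraMap Kq R q) x a.1 *
      H (a.1 + b.1) b.2) * h
  | succ P ih =>
    -- One particle peeled off `P` changes the test function in the same way on both sides. On the
    -- right, the terms `∓ x q^b.2` from the inhomogeneous vertex and from the vertex of parameter
    -- `1` cancel.
    have hL := ih fun s v => H s (v + 1) + x * algebraMap Kq R q ^ v * H (s + 1) v
    rw [sum_inhWeight_succ x (fun r u => ∑ c ∈ antidiagonal (A + r),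
      whitWeight 1 c.1 c.2 * H c.1 (c.2 + u))]
    refine Eq.trans (sum_congr rfl fun a _ => congrArg _ (congrArg _ ?_)) (hL.trans ?_)
    · rw [← add_assoc, sum_whitWeight_succ x (fun s v => H (s + a.1) v)]
      simp only [add_right_comm _ 1]
    · refine sum_congr rfl fun b _ => congrArg _ ?_
      rw [← add_assoc, sum_whitWeight_succ 1 (fun s v => H s (v + b.2))]
      simp only [mul_sum, ← sum_add_distrib]
      refine sum_congr rfl fun c _ => ?_
      simp only [add_right_comm _ 1, ← add_assoc]
      ring

/-- The local exchange relation of an inhomogeneous vertex with a column of two `q`-Whittaker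
vertices with parameters `1` and `x`, as an identity of linear functionals on the functions of the
right and top labels. -/
theorem exchange (x : R) (a P : ℕ) (H : ℕ → ℕ → ℕ → R) :
    ∑ p ∈ antidiagonal a, whitWeight 1 p.1 p.2 *
        ∑ b ∈ antidiagonal (p.2 + P), whitWeight x b.1 b.2 *
          ∑ s ∈ antidiagonal p.1, inhWeight x s.1 s.2 * H s.1 (b.1 + s.2) b.2 =
      ∑ b ∈ antidiagonal P, inhWeight x b.1 b.2 *
        ∑ p ∈ antidiagonal a, whitWeight x p.1 p.2 *
          ∑ c ∈ antidiagonal (p.2 + b.1), whitWeight 1 c.1 c.2 * H p.1 c.1 (c.2 + b.2) := by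
  have hl : ∀ p ∈ antidiagonal a, whitWeight 1 p.1 p.2 *
        ∑ b ∈ antidiagonal (p.2 + P), whitWeight x b.1 b.2 *
          ∑ s ∈ antidiagonal p.1, inhWeight x s.1 s.2 * H s.1 (b.1 + s.2) b.2 =
      ∑ s ∈ antidiagonal p.1, whitWeight 1 (s.1 + s.2) p.2 * inhWeight x s.1 s.2 *
        ∑ b ∈ antidiagonal (p.2 + P), whitWeight x b.1 b.2 * H s.1 (b.1 + s.2) b.2 := by
    intro p _
    simp only [mul_sum]
    rw [sum_comm]
    refine sum_congr rfl fun s hs => sum_congr rfl fun b _ => ?_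
    rw [HasAntidiagonal.mem_antidiagonal.1 hs]
    ring
  rw [sum_congr rfl hl, sum_antidiagonal_assoc a (fun r u e => whitWeight 1 (r + u) e *
    inhWeight x r u * ∑ b ∈ antidiagonal (e + P), whitWeight x b.1 b.2 * H r (b.1 + u) b.2)]
  -- The `r` particles that turn right in both rows are now the outer index; dividing out their
  -- weight `whitWeight x` leaves `exchange_reduced`.
  simp only [mul_sum (antidiagonal a)]
  rw [sum_comm]
  refine sum_congr rfl fun p _ => ?_
  have h := congrArg (fun y => whitWeight x p.1 p.2 * y) (exchange_reduced x p.2 P (H p.1))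
  refine Eq.trans ?_ (h.trans ?_)
  · simp only [mul_sum]
    refine sum_congr rfl fun s hs => sum_congr rfl fun b _ => ?_
    rw [← HasAntidiagonal.mem_antidiagonal.1 hs]
    have h := congrArg (algebraMap Kq R) (gaussBinom_mul_gaussBinom p.1 s.1 s.2)
    simp only [map_mul] at h
    simp only [inhWeight, whitWeight, gaussBinom_zero_left, map_one, one_mul, pow_zero,
      one_pow, mul_one]
    linear_combination (x ^ p.1 * qPochhammer (algebraMap Kq R q) x s.1 *
      (algebraMap Kq R (gaussBinom b.1 b.2) * x ^ b.1) * H p.1 (b.1 + s.1) b.2) * h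
  · simp only [mul_sum]
    refine sum_congr rfl fun s _ => sum_congr rfl fun b _ => ?_
    ring

end Weights

/-! ### Row transfer operators -/

section Row

variable {R : Type*} [CommRing R]

/-- The transfer operator of a row. The list contains the bottom labels from left to right, `b` is
the left label, and `f` is applied to the right label and to the list of the top labels. -/
def rowOp (w : ℕ → ℕ → R) : List ℕ → ℕ → (ℕ → List ℕ → R) → R
  | [], b, f => f b []
  | a :: as, b, f =>
    ∑ p ∈ antidiagonal a, w p.1 p.2 * rowOp w as p.1 (fun r cs => f r ((p.2 + b) :: cs))

/-- The transfer operator of a row whose leftmost column has to be emptied; this column is dropped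
from the list of the top labels. -/
def shrinkOp (w : ℕ → ℕ → R) : List ℕ → (ℕ → List ℕ → R) → R
  | [], _ => 0
  | a :: as, f => w a 0 * rowOp w as a f

theorem rowOp_congr (w : ℕ → ℕ → R) (as : List ℕ) (b : ℕ) {f g : ℕ → List ℕ → R}
    (h : ∀ r cs, cs.length = as.length → r + cs.sum = as.sum + b → f r cs = g r cs) :
    rowOp w as b f = rowOp w as b g := by
  induction as generalizing b f g with
  | nil => exact h b [] rfl (by simp)
  | cons a as ih =>
    refine sum_congr rfl fun p hp => congrArg _ (ih _ fun r cs h1 h2 => h _ _ (by simp [h1]) ?_)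
    rw [HasAntidiagonal.mem_antidiagonal] at hp
    simp only [List.sum_cons]
    omega

theorem rowOp_sum {ι : Type*} (w : ℕ → ℕ → R) (as : List ℕ) (b : ℕ) (s : Finset ι)
    (c : ι → R) (f : ι → ℕ → List ℕ → R) :
    rowOp w as b (fun r cs => ∑ i ∈ s, c i * f i r cs) = ∑ i ∈ s, c i * rowOp w as b (f i) := by
  induction as generalizing b f with
  | nil => rfl
  | cons a as ih =>
    simp only [rowOp, ih, mul_sum]
    rw [sum_comm]
    exact sum_congr rfl fun i _ => sum_congr rfl fun p _ => by ring

theorem rowOp_mul_left (w : ℕ → ℕ → R) (as : List ℕ) (b : ℕ) (c : R) (f : ℕ → List ℕ → R) :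
    rowOp w as b (fun r cs => c * f r cs) = c * rowOp w as b f := by
  simpa using rowOp_sum w as b {()} (fun _ => c) (fun _ => f)

theorem rowOp_append_singleton (w : ℕ → ℕ → R) (as : List ℕ) (a b : ℕ) (f : ℕ → List ℕ → R) :
    rowOp w (as ++ [a]) b f =
      rowOp w as b (fun r cs =>
        ∑ p ∈ antidiagonal a, w p.1 p.2 * f p.1 (cs ++ [p.2 + r])) := by
  induction as generalizing b f with
  | nil => rfl
  | cons c as ih => simp only [List.cons_append, rowOp, ih]

theorem map_rowOp {S : Type*} [CommRing S] (φ : R →+* S) (w : ℕ → ℕ → R) (as : List ℕ) (b : ℕ)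
    (f : ℕ → List ℕ → R) :
    φ (rowOp w as b f) = rowOp (fun d e => φ (w d e)) as b (fun r cs => φ (f r cs)) := by
  induction as generalizing b f with
  | nil => rfl
  | cons a as ih => simp only [rowOp, map_sum, map_mul, ih]

theorem shrinkOp_congr (w : ℕ → ℕ → R) (as : List ℕ) {f g : ℕ → List ℕ → R}
    (h : ∀ r cs, cs.length + 1 = as.length → r + cs.sum = as.sum → f r cs = g r cs) :
    shrinkOp w as f = shrinkOp w as g := by
  rcases as with _ | ⟨a, as⟩
  · rfl
  · refine congrArg (w a 0 * ·) (rowOp_congr w as a fun r cs h1 h2 => h r cs (by simp [h1]) ?_)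
    simp only [List.sum_cons]
    omega

theorem shrinkOp_sum {ι : Type*} (w : ℕ → ℕ → R) (as : List ℕ) (s : Finset ι)
    (c : ι → R) (f : ι → ℕ → List ℕ → R) :
    shrinkOp w as (fun r cs => ∑ i ∈ s, c i * f i r cs) = ∑ i ∈ s, c i * shrinkOp w as (f i) := by
  rcases as with _ | ⟨a, as⟩
  · simp [shrinkOp]
  · simp only [shrinkOp, rowOp_sum, mul_sum]
    exact sum_congr rfl fun i _ => by ring

theorem shrinkOp_append_singleton (w : ℕ → ℕ → R) (as : List ℕ) (has : as ≠ []) (a : ℕ)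
    (f : ℕ → List ℕ → R) :
    shrinkOp w (as ++ [a]) f =
      shrinkOp w as (fun r cs =>
        ∑ p ∈ antidiagonal a, w p.1 p.2 * f p.1 (cs ++ [p.2 + r])) := by
  rcases as with _ | ⟨c, as⟩
  · exact absurd rfl has
  · simp only [List.cons_append, shrinkOp, rowOp_append_singleton]

end Row

/-! ### Row exchange and the expansion lattice -/

section Exchange

variable {R : Type*} [CommRing R] [Algebra Kq R]

/-- The left boundary relation: an inhomogeneous vertex that reaches the left end of the two rows is
absorbed and turns parameter `1` into `x`. For fixed `p`, the q-trinomial identity leaves a sum of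
inhomogeneous weights, which is `1`. -/
theorem sum_whitWeight_one_mul (x : R) (n : ℕ) (K : ℕ → ℕ → R) :
    ∑ p ∈ antidiagonal n, whitWeight 1 p.1 p.2 *
        (x ^ p.2 * ∑ s ∈ antidiagonal p.1, inhWeight x s.1 s.2 * K s.1 (p.2 + s.2)) =
      ∑ p ∈ antidiagonal n, whitWeight x p.1 p.2 * K p.1 p.2 := by
  have hl : ∀ p ∈ antidiagonal n, whitWeight 1 p.1 p.2 *
        (x ^ p.2 * ∑ s ∈ antidiagonal p.1, inhWeight x s.1 s.2 * K s.1 (p.2 + s.2)) =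
      ∑ s ∈ antidiagonal p.1, whitWeight 1 (s.1 + s.2) p.2 * x ^ p.2 *
        inhWeight x s.1 s.2 * K s.1 (s.2 + p.2) := by
    intro p _
    simp only [mul_sum]
    refine sum_congr rfl fun s hs => ?_
    rw [HasAntidiagonal.mem_antidiagonal.1 hs, add_comm s.2]
    ring
  rw [sum_congr rfl hl, sum_antidiagonal_assoc n (fun r u e => whitWeight 1 (r + u) e * x ^ e *
    inhWeight x r u * K r (u + e))]
  refine sum_congr rfl fun p _ => ?_
  refine Eq.trans ?_ ((congrArg (whitWeight x p.1 p.2 * K p.1 p.2 * ·)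
    ((Nat.sum_antidiagonal_swap (f := fun s => inhWeight x s.1 s.2)).trans
      (sum_inhWeight x p.2))).trans (mul_one _))
  rw [mul_sum]
  refine sum_congr rfl fun s hs => ?_
  rw [← HasAntidiagonal.mem_antidiagonal.1 hs]
  have h := congrArg (algebraMap Kq R) (gaussBinom_mul_gaussBinom p.1 s.1 s.2)
  simp only [map_mul] at h
  simp only [inhWeight, whitWeight, gaussBinom_comm s.2 s.1, Prod.fst_swap, Prod.snd_swap,
    one_pow, mul_one]
  linear_combination (x ^ p.1 * x ^ s.2 * qPochhammer (algebraMap Kq R q) x s.1 *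
    K p.1 (s.1 + s.2)) * h

/-- The exchange relation of two rows with parameters `1` and `x`: an inhomogeneous vertex is
pulled through all the columns. -/
theorem rowOp_exchange (x : R) (as : List ℕ) (p t : ℕ) (G : ℕ → ℕ → List ℕ → R) :
    rowOp (whitWeight 1) as p (fun p' ρ => ∑ s ∈ antidiagonal p', inhWeight x s.1 s.2 *
        rowOp (whitWeight x) ρ t (fun t' σ => G s.1 (t' + s.2) σ)) =
      ∑ s ∈ antidiagonal p, inhWeight x s.1 s.2 *
        rowOp (whitWeight x) as s.1 (fun r κ => rowOp (whitWeight 1) κ (t + s.2) (G r)) := by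
  induction as generalizing p t G with
  | nil => rfl
  | cons a as ih =>
    -- The local relation for the first column, with the remaining columns of both rows, already in
    -- swapped order, as test function.
    have h := exchange x a p fun r s v => rowOp (whitWeight x) as r
      (fun r' κ => rowOp (whitWeight 1) κ s (fun s' σ => G r' s' ((v + t) :: σ)))
    refine Eq.trans ?_ (h.trans ?_)
    · simp only [rowOp]
      refine sum_congr rfl fun d _ => congrArg _ ?_
      -- The upper vertex of the first column does not depend on the rest of the lower row, so its
      -- sum moves out of that row's operator before the induction hypothesis applies.
      refine (rowOp_congr _ _ _ fun r cs _ _ => ?_).trans ((rowOp_sum (whitWeight 1) as d.1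
        (antidiagonal (d.2 + p)) (fun b => whitWeight x b.1 b.2) (fun b r cs =>
          ∑ s ∈ antidiagonal r, inhWeight x s.1 s.2 * rowOp (whitWeight x) cs b.1
            (fun t' σ => G s.1 (t' + s.2) ((b.2 + t) :: σ)))).trans ?_)
      · simp only [mul_sum]
        rw [sum_comm]
        exact sum_congr rfl fun _ _ => sum_congr rfl fun _ _ => by ring
      refine sum_congr rfl fun b _ => congrArg _ ?_
      exact ih d.1 b.1 fun r s σ => G r s ((b.2 + t) :: σ)
    · simp only [rowOp, rowOp_sum]
      refine sum_congr rfl fun b _ => congrArg _ (sum_congr rfl fun d _ => congrArg _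
        (sum_congr rfl fun c _ => congrArg _ ?_))
      simp only [add_assoc, add_comm b.2 t]

/-- The expansion operator: `f` is applied to the list of the right labels from top to bottom of
the lattice with weights `whitWeight 1`. -/
def expansionOp : ℕ → List ℕ → (List ℕ → R) → R
  | 0, _, f => f []
  | n + 1, as, f =>
    shrinkOp (whitWeight 1) as (fun r ρ => expansionOp n ρ (fun μ => f (μ ++ [r])))

theorem expansionOp_sum {ι : Type*} (n : ℕ) (as : List ℕ) (s : Finset ι)
    (c : ι → R) (f : ι → List ℕ → R) :
    expansionOp n as (fun μ => ∑ i ∈ s, c i * f i μ) =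
      ∑ i ∈ s, c i * expansionOp n as (f i) := by
  induction n generalizing as f with
  | zero => rfl
  | succ n ih => simp only [expansionOp, ih, shrinkOp_sum]

theorem expansionOp_congr (n : ℕ) (as : List ℕ) (hn : as.length = n) {f g : List ℕ → R}
    (h : ∀ μ : List ℕ, μ.length = n → μ.sum = as.sum → f μ = g μ) :
    expansionOp n as f = expansionOp n as g := by
  induction n generalizing as f g with
  | zero =>
    obtain rfl := List.length_eq_zero_iff.1 hn
    exact h [] rfl rfl
  | succ n ih =>
    refine shrinkOp_congr _ as fun r ρ h1 h2 => ih ρ (by omega) fun μ h3 h4 => h _ ?_ ?_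
    · simp [h3]
    · simp only [List.sum_append, List.sum_singleton]
      omega

/-- An inhomogeneous row attached to the right boundary of the expansion lattice is pulled through
to its bottom, where it becomes a q-Whittaker row; the expansion lattice loses one row and one
column. -/
theorem expansionOp_shrinkOp (x : R) (n : ℕ) (as : List ℕ) (hn : as.length = n + 1)
    (f : ℕ → List ℕ → R) :
    expansionOp (n + 1) as (fun μ => shrinkOp (inhWeight x) μ f) =
      shrinkOp (whitWeight x) as (fun p κ => expansionOp n κ (f p)) := by
  induction n generalizing as f with
  | zero =>
    obtain ⟨a, rfl⟩ := List.length_eq_one_iff.1 hn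
    simp [expansionOp, shrinkOp, rowOp, whitWeight_zero_right, inhWeight_zero_right]
  | succ n ih =>
    obtain ⟨a, as, rfl⟩ := List.exists_cons_of_length_eq_add_one hn
    obtain ⟨a', as, rfl⟩ := List.exists_cons_of_length_eq_add_one
      (show as.length = n + 1 by simpa using hn)
    rw [expansionOp, shrinkOp, whitWeight_zero_right, one_pow, one_mul, shrinkOp,
      whitWeight_zero_right]
    -- The last column of the inhomogeneous row, fed by the output `r` of the lowest row, is split
    -- off as one vertex; the induction hypothesis pulls the other columns through the rows above.
    have h1 : rowOp (whitWeight 1) (a' :: as) a (fun r ρ => expansionOp (n + 1) ρ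
          (fun μ => shrinkOp (inhWeight x) (μ ++ [r]) f)) =
        rowOp (whitWeight 1) (a' :: as) a (fun r ρ => ∑ s ∈ antidiagonal r, inhWeight x s.1 s.2 *
          shrinkOp (whitWeight x) ρ (fun p κ =>
            expansionOp n κ (fun μ => f s.1 (μ ++ [p + s.2])))) := by
      refine rowOp_congr _ _ _ fun r ρ h1 _ => ?_
      refine Eq.trans (expansionOp_congr (n + 1) ρ (by simpa [h1] using hn) fun μ h3 _ =>
        shrinkOp_append_singleton (inhWeight x) μ (by rintro rfl; simp at h3) r f) ?_
      refine (ih ρ (by simpa [h1] using hn) _).trans ?_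
      simp only [expansionOp_sum, shrinkOp_sum, add_comm]
    let G : ℕ → ℕ → List ℕ → R := fun d s κ => expansionOp n κ (fun μ => f d (μ ++ [s]))
    have h2 := sum_whitWeight_one_mul x a' fun r c => rowOp (whitWeight x) as r
      (fun r' κ => rowOp (whitWeight 1) κ (c + a) (G r'))
    rw [h1, rowOp, rowOp]
    refine Eq.trans ?_ ((congrArg (x ^ a * ·) h2).trans ?_)
    · rw [mul_sum]
      refine sum_congr rfl fun p _ => ?_
      -- The split-off vertex passes the columns `as`; `h2` then absorbs it in the column `a'`,
      -- where the upper row has to empty `p.2 + a` particles.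
      have h3 := rowOp_exchange x as p.1 (p.2 + a) G
      simp only [shrinkOp, whitWeight_zero_right, mul_left_comm _ (x ^ (p.2 + a)), ← mul_sum,
        rowOp_mul_left]
      rw [h3, pow_add]
      simp only [add_right_comm _ a]
      ring
    · simp only [expansionOp, shrinkOp, whitWeight_zero_right, one_pow, one_mul]
      rfl

end Exchange

/-! ### Partition functions of whole lattices, row by row -/

section Iterates

variable {R : Type*} [CommRing R]

/-- The partition function of a lattice with as many rows as columns and with empty top boundary,
whose leftmost nonempty column is emptied by every row; `S i` is the set of the labels allowed at
the right end of row `i`. -/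
def shrinkIter : (n : ℕ) → (Fin n → ℕ → ℕ → R) → (Fin n → Set ℕ) → List ℕ → R
  | 0, _, _, _ => 1
  | n + 1, w, S, as => shrinkOp (w 0) as fun r cs =>
      (S 0).indicator (fun _ => shrinkIter n (Fin.tail w) (Fin.tail S) cs) r

/-- The partition function of a lattice with empty left and top boundaries. -/
def rowIter : (n : ℕ) → (Fin n → ℕ → ℕ → R) → (Fin n → Set ℕ) → List ℕ → R
  | 0, _, _, as => if as.sum = 0 then 1 else 0
  | n + 1, w, S, as => rowOp (w 0) as 0 fun r cs =>
      (S 0).indicator (fun _ => rowIter n (Fin.tail w) (Fin.tail S) cs) r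

theorem rowIter_zero_cons (n : ℕ) (w : Fin n → ℕ → ℕ → R) (hw : ∀ i, w i 0 0 = 1)
    (S : Fin n → Set ℕ) (as : List ℕ) : rowIter n w S (0 :: as) = rowIter n w S as := by
  induction n generalizing as with
  | zero => simp [rowIter]
  | succ n ih =>
    simp [rowIter, rowOp, hw, ih (Fin.tail w) fun i => hw i.succ]

/-- A particle moves at most one column to the right per row, so it needs at least `n + 1` rows to
leave past `n` or more further columns. -/
theorem rowIter_eq_zero (n : ℕ) (w : Fin n → ℕ → ℕ → R) (hw : ∀ i, w i 0 0 = 1)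
    (S : Fin n → Set ℕ) (a : ℕ) (as : List ℕ) (ha : a ≠ 0) (has : n ≤ as.length) :
    rowIter n w S (a :: as) = 0 := by
  induction n generalizing a as with
  | zero => simp [rowIter, ha]
  | succ n ih =>
    obtain ⟨a', as, rfl⟩ := List.exists_cons_of_length_eq_add_one
      (show as.length = (as.length - 1) + 1 by omega)
    have hw' : ∀ i, Fin.tail w i 0 0 = 1 := fun i => hw i.succ
    rw [List.length_cons, Nat.add_le_add_iff_right] at has
    rw [rowIter, rowOp]
    refine sum_eq_zero fun p hp => ?_
    rw [rowOp, sum_eq_zero, mul_zero]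
    intro s _
    rw [rowOp_congr (g := fun _ _ => 0 * 0), rowOp_mul_left, zero_mul, mul_zero]
    intro r cs hcs _
    rw [mul_zero, Set.indicator_apply_eq_zero]
    intro _
    rcases Nat.eq_zero_or_pos p.2 with h0 | h0
    · rw [h0, rowIter_zero_cons n _ hw', ih _ hw']
      · have := HasAntidiagonal.mem_antidiagonal.1 hp
        omega
      · omega
    · refine ih _ hw' _ _ _ (by omega) ?_
      simp only [List.length_cons]
      omega

/-- Particles left behind in the first column could no longer escape, by `rowIter_eq_zero`; the
emptied column is then irrelevant to the later rows. -/
theorem rowIter_eq_shrinkIter (n : ℕ) (w : Fin n → ℕ → ℕ → R) (hw : ∀ i, w i 0 0 = 1)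
    (S : Fin n → Set ℕ) (as : List ℕ) (has : as.length = n) :
    rowIter n w S as = shrinkIter n w S as := by
  induction n generalizing as with
  | zero =>
    obtain rfl := List.length_eq_zero_iff.1 has
    simp [rowIter, shrinkIter]
  | succ n ih =>
    obtain ⟨a, as, rfl⟩ := List.exists_cons_of_length_eq_add_one has
    have hw' : ∀ i, Fin.tail w i 0 0 = 1 := fun i => hw i.succ
    rw [List.length_cons, Nat.add_right_cancel_iff] at has
    rw [rowIter, shrinkIter, rowOp, shrinkOp,
      sum_eq_single_of_mem (a, 0) (by simp) fun p hp hne => ?_]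
    · refine congrArg _ (rowOp_congr _ _ _ fun r cs hcs _ => ?_)
      rw [zero_add, rowIter_zero_cons n _ hw', ih _ hw' _ _ (by omega)]
    · rw [rowOp_congr (g := fun _ _ => 0 * 0), rowOp_mul_left, zero_mul, mul_zero]
      intro r cs hcs _
      rw [mul_zero, Set.indicator_apply_eq_zero]
      intro _
      refine rowIter_eq_zero n _ hw' _ _ _ (fun h => hne ?_) (by omega)
      have := HasAntidiagonal.mem_antidiagonal.1 hp
      ext <;> simp <;> omega

theorem shrinkIter_eq_zero (n : ℕ) (w : Fin n → ℕ → ℕ → R) (m : Fin n → ℕ) (as : List ℕ)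
    (has : as.length = n) (h : ∑ i, m i ≠ as.sum) :
    shrinkIter n w (fun i => {m i}) as = 0 := by
  induction n generalizing as with
  | zero =>
    obtain rfl := List.length_eq_zero_iff.1 has
    simp at h
  | succ n ih =>
    rw [shrinkIter, shrinkOp_congr (g := fun _ _ => 0 * 0)]
    · rcases as with _ | ⟨a, as⟩
      · rfl
      · rw [shrinkOp, rowOp_mul_left, zero_mul, mul_zero]
    · intro r cs h1 h2
      rw [mul_zero, Set.indicator_apply_eq_zero, Set.mem_singleton_iff]
      rintro rfl
      refine ih _ (fun i => m i.succ) cs (by omega) fun h3 => h ?_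
      rw [Fin.sum_univ_succ, h3, h2]

theorem map_shrinkIter {S : Type*} [CommRing S] (φ : R →+* S) (n : ℕ) (w : Fin n → ℕ → ℕ → R)
    (T : Fin n → Set ℕ) (as : List ℕ) :
    φ (shrinkIter n w T as) = shrinkIter n (fun i d e => φ (w i d e)) T as := by
  induction n generalizing as with
  | zero => simp [shrinkIter]
  | succ n ih =>
    have hφ : ∀ (A : Set ℕ) (c : R) (r : ℕ),
        φ (A.indicator (fun _ => c) r) = A.indicator (fun _ => φ c) r := by
      intro A c r
      by_cases h : r ∈ A <;> simp [h]
    rcases as with _ | ⟨a, as⟩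
    · simp [shrinkIter, shrinkOp]
    · simp only [shrinkIter, shrinkOp, map_mul, map_rowOp, hφ, ih]
      rfl

end Iterates

theorem sum_fin_succ_fun {α M : Type*} [Fintype α] [AddCommMonoid M] (n : ℕ)
    (F : (Fin (n + 1) → α) → M) :
    ∑ v, F v = ∑ a, ∑ v : Fin n → α, F (Fin.cons a v) := by
  rw [← Fintype.sum_prod_type' (fun a (v : Fin n → α) => F (Fin.cons a v))]
  exact (Fintype.sum_equiv (Fin.consEquiv fun _ => α) _ _ fun _ => rfl).symm

/-! ### The expansion for whole lattices -/

section Expansion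

variable {R : Type*} [CommRing R] [Algebra Kq R]

theorem expansionOp_shrinkIter (n : ℕ) (x : Fin n → R) (as : List ℕ) (has : as.length = n) :
    expansionOp n as (shrinkIter n (fun i => inhWeight (x i)) fun _ => Set.univ) =
      shrinkIter n (fun i => whitWeight (x i)) (fun _ => Set.univ) as := by
  induction n generalizing as with
  | zero => rfl
  | succ n ih =>
    refine (expansionOp_shrinkOp (x 0) n as has _).trans (shrinkOp_congr _ _ fun r cs h _ => ?_)
    simp only [Set.indicator_univ]
    exact ih (fun i => x i.succ) cs (by omega)

/-- Sorts the configurations by their right labels `m`. The list is reversed because `m` runs from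
bottom to top, while `f` reads from top to bottom. -/
theorem expansionOp_eq_sum (B n : ℕ) (as : List ℕ) (has : as.length = n) (hB : as.sum < B)
    (f : List ℕ → R) :
    expansionOp n as f = ∑ m : Fin n → Fin B,
      shrinkIter n (fun _ => whitWeight 1) (fun i => {(m i : ℕ)}) as *
        f (List.ofFn fun i => (m i : ℕ)).reverse := by
  induction n generalizing as f with
  | zero => simp [expansionOp, shrinkIter]
  | succ n ih =>
    rw [sum_fin_succ_fun, expansionOp,
      ← Fintype.sum_prod_type' (fun (a : Fin B) (v : Fin n → Fin B) => shrinkIter (n + 1)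
        (fun _ => whitWeight 1) (fun i => {((Fin.cons a v : Fin (n + 1) → Fin B) i : ℕ)}) as *
          f (List.ofFn fun i => ((Fin.cons a v : Fin (n + 1) → Fin B) i : ℕ)).reverse)]
    simp only [List.ofFn_succ, Fin.cons_zero, Fin.cons_succ, List.reverse_cons]
    simp only [shrinkIter, mul_comm (shrinkOp _ _ _), ← shrinkOp_sum]
    refine shrinkOp_congr _ _ fun r cs h1 h2 => ?_
    rw [Fintype.sum_prod_type, sum_eq_single (⟨r, by omega⟩ : Fin B)]
    · rw [ih cs (by omega) (by omega)]
      refine sum_congr rfl fun v _ => ?_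
      rw [Fin.cons_zero, Set.indicator_of_mem (Set.mem_singleton _), mul_comm]
      rfl
    · intro a _ ha
      refine sum_eq_zero fun v _ => ?_
      rw [Fin.cons_zero, Set.indicator_of_notMem, mul_zero]
      rintro rfl
      exact ha rfl
    · simp

end Expansion

/-! ### From edge labellings to row operators -/

section Lattice

variable {R : Type*} [CommRing R]

/-- A vertex weight obeying the conservation law `a + b = c + d` and vanishing unless `b ≤ c`, in
terms of a weight of the numbers of particles from the bottom that turn right and go up. -/
def vertexWeight (w : ℕ → ℕ → R) (a b c d : ℕ) : R :=
  if a + b = c + d ∧ b ≤ c then w d (c - b) else 0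

theorem sum_vertexWeight (w : ℕ → ℕ → R) (B a b : ℕ) (h : a + b < B) (K : ℕ → ℕ → R) :
    ∑ c : Fin B, ∑ d : Fin B, vertexWeight w a b c d * K c d =
      ∑ p ∈ antidiagonal a, w p.1 p.2 * K (p.2 + b) p.1 := by
  have h1 : ∑ c : Fin B, ∑ d : Fin B, vertexWeight w a b c d * K c d =
      ∑ t : Fin B × Fin B with a + b = t.1 + t.2 ∧ b ≤ t.1,
        w t.2 (t.1 - b) * K t.1 t.2 := by
    rw [← Fintype.sum_prod_type' (fun c d : Fin B => vertexWeight w a b c d * K c d), sum_filter]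
    simp only [vertexWeight, ite_mul, zero_mul]
  rw [h1]
  refine sum_bij' (fun t _ => ((t.2 : ℕ), (t.1 : ℕ) - b))
    (fun p hp => (⟨p.2 + b, ?_⟩, ⟨p.1, ?_⟩)) ?_ ?_ ?_ ?_ ?_
  · have := HasAntidiagonal.mem_antidiagonal.1 hp
    omega
  · have := HasAntidiagonal.mem_antidiagonal.1 hp
    omega
  · intro t ht
    simp only [mem_filter, mem_univ, true_and, HasAntidiagonal.mem_antidiagonal] at ht ⊢
    omega
  · intro p hp
    simp only [mem_filter, mem_univ, true_and, HasAntidiagonal.mem_antidiagonal] at hp ⊢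
    omega
  · intro t ht
    simp only [mem_filter, mem_univ, true_and] at ht
    ext <;> simp
    omega
  · intro p hp
    simp
  · intro t ht
    simp only [mem_filter, mem_univ, true_and] at ht
    rw [Nat.sub_add_cancel ht.2]

/-- The sum over the horizontal labels of a row and over its top labels is `rowOp`. -/
theorem sum_row_eq_rowOp (w : ℕ → ℕ → R) (B N : ℕ) (a : Fin N → ℕ) (b : ℕ)
    (h : ∑ j, a j + b < B) (f : ℕ → List ℕ → R) :
    ∑ c : Fin N → Fin B, ∑ g : Fin (N + 1) → Fin B, (if (g 0 : ℕ) = b then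
        ∏ j : Fin N, vertexWeight w (a j) (g j.castSucc) (c j) (g j.succ) else 0) *
          f (g (Fin.last N)) (List.ofFn fun j => (c j : ℕ)) =
      rowOp w (List.ofFn a) b f := by
  induction N generalizing b f with
  | zero =>
    rw [Fintype.sum_unique, sum_fin_succ_fun, sum_eq_single (⟨b, by omega⟩ : Fin B)]
    · simp [rowOp]
    · intro g _ hg
      refine sum_eq_zero fun v _ => ?_
      rw [Fin.cons_zero, if_neg, zero_mul]
      rintro rfl
      exact hg rfl
    · simp
  | succ N ih =>
    rw [Fin.sum_univ_succ] at h
    rw [List.ofFn_succ, rowOp, ← sum_vertexWeight w B (a 0) b (by omega) (fun c d =>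
      rowOp w (List.ofFn fun j => a j.succ) d (fun r cs => f r (c :: cs))), sum_fin_succ_fun]
    refine sum_congr rfl fun c0 _ => ?_
    have h1 : ∀ d : Fin B, vertexWeight w (a 0) b c0 d *
        rowOp w (List.ofFn fun j => a j.succ) d (fun r cs => f r ((c0 : ℕ) :: cs)) =
        vertexWeight w (a 0) b c0 d * ∑ c : Fin N → Fin B, ∑ g : Fin (N + 1) → Fin B,
          (if (g 0 : ℕ) = d then ∏ j : Fin N,
            vertexWeight w (a j.succ) (g j.castSucc) (c j) (g j.succ) else 0) *
              f (g (Fin.last N)) ((c0 : ℕ) :: List.ofFn fun j => (c j : ℕ)) := by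
      intro d
      -- The induction hypothesis needs the remaining particles to stay below `B`; conservation
      -- ensures this whenever the vertex weight is not zero.
      by_cases hd : a 0 + b = c0 + d ∧ b ≤ c0
      · rw [ih (fun j => a j.succ) d (by omega) (fun r cs => f r ((c0 : ℕ) :: cs))]
      · rw [vertexWeight, if_neg hd, zero_mul, zero_mul]
    rw [sum_congr rfl fun d _ => h1 d]
    simp only [mul_sum]
    conv_rhs => rw [sum_comm]
    refine sum_congr rfl fun c _ => ?_
    conv_rhs => rw [sum_comm]
    rw [sum_fin_succ_fun, sum_eq_single (⟨b, by omega⟩ : Fin B)]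
    · refine sum_congr rfl fun g _ => ?_
      rw [sum_eq_single (g 0)]
      · simp [Fin.prod_univ_succ, List.ofFn_succ, mul_assoc, ← Fin.succ_last]
      · intro d _ hd
        rw [if_neg, zero_mul, mul_zero]
        exact fun h => hd (Fin.ext h.symm)
      · simp
    · intro g0 _ hg
      refine sum_eq_zero fun v _ => ?_
      rw [Fin.cons_zero, if_neg, zero_mul]
      rintro rfl
      exact hg rfl
    · simp

open Classical in
/-- The partition function of a lattice with empty left and top boundaries whose labels are
less than `B`. -/
def boundedSum (B M N : ℕ) (w : Fin M → Fin N → ℕ → ℕ → ℕ → ℕ → R) (bottom : Fin N → ℕ)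
    (right : Fin M → Set ℕ) : R :=
  ∑ v : Fin (M + 1) → Fin N → Fin B, ∑ h : Fin M → Fin (N + 1) → Fin B,
    if (∀ j, (v 0 j : ℕ) = bottom j) ∧ (∀ i, (h i 0 : ℕ) = 0) ∧
        (∀ j, (v (Fin.last M) j : ℕ) = 0) ∧ (∀ i, (h i (Fin.last N) : ℕ) ∈ right i)
    then ∏ i : Fin M, ∏ j : Fin N,
      w i j (v i.castSucc j) (h i j.castSucc) (v i.succ j) (h i j.succ)
    else 0

open Classical in
theorem boundedSum_succ (B M N : ℕ) (w : Fin (M + 1) → Fin N → ℕ → ℕ → ℕ → ℕ → R)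
    (bottom : Fin N → ℕ) (hB : ∀ j, bottom j < B) (right : Fin (M + 1) → Set ℕ) :
    boundedSum B (M + 1) N w bottom right =
      ∑ c : Fin N → Fin B, ∑ g : Fin (N + 1) → Fin B, (if (g 0 : ℕ) = 0 then
        ∏ j : Fin N, w 0 j (bottom j) (g j.castSucc) (c j) (g j.succ) else 0) *
          (right 0).indicator (fun _ => boundedSum B M N (Fin.tail w) (fun j => c j)
            (Fin.tail right)) (g (Fin.last N)) := by
  have hind : ∀ (A : Set ℕ) (y : R) (r : ℕ),
      A.indicator (fun _ => y) r = (if r ∈ A then 1 else 0) * y := by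
    intro A y r
    by_cases h : r ∈ A <;> simp [h]
  simp only [boundedSum, hind, mul_sum]
  conv_rhs =>
    rw [sum_congr rfl fun c _ => sum_comm, sum_comm]
  rw [sum_fin_succ_fun, sum_eq_single (fun j => (⟨bottom j, hB j⟩ : Fin B))]
  · refine sum_congr rfl fun v _ => ?_
    rw [sum_eq_single (v 0), sum_fin_succ_fun]
    · refine sum_congr rfl fun g _ => sum_congr rfl fun h _ => ?_
      simp only [Fin.forall_fin_succ, Fin.prod_univ_succ, ← Fin.succ_last, Fin.cons_zero,
        Fin.cons_succ, Fin.castSucc_zero, Fin.tail, ← Fin.succ_castSucc]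
      by_cases h1 : (g 0 : ℕ) = 0 <;> by_cases h2 : (g (Fin.last N) : ℕ) ∈ right 0 <;>
        simp [h1, h2]
    · intro c _ hc
      refine sum_eq_zero fun g _ => sum_eq_zero fun h _ => ?_
      have hne : ¬ ∀ j, (v 0 j : ℕ) = c j := fun hh => hc (funext fun j => Fin.ext (hh j).symm)
      simp only [hne, false_and, if_false, mul_zero]
    · simp
  · intro v0 _ hv
    refine sum_eq_zero fun v _ => sum_eq_zero fun h _ => if_neg fun hh => hv ?_
    exact funext fun j => Fin.ext (by simpa using hh.1 j)
  · simp

/-- The bound `B` is kept independent of the bottom labels, since the number of particles can drop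
from row to row during the induction. -/
theorem boundedSum_eq_rowIter (B M N : ℕ) (w : Fin M → ℕ → ℕ → R) (bottom : Fin N → ℕ)
    (hB : ∑ j, bottom j < B) (right : Fin M → Set ℕ) :
    boundedSum B M N (fun i _ => vertexWeight (w i)) bottom right =
      rowIter M w right (List.ofFn bottom) := by
  have hle : ∀ j, bottom j < B := fun j =>
    (single_le_sum (fun _ _ => Nat.zero_le _) (mem_univ j)).trans_lt hB
  induction M generalizing bottom with
  | zero =>
    rw [boundedSum, sum_fin_succ_fun, sum_eq_single (fun j => (⟨bottom j, hle j⟩ : Fin B))]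
    · simp [rowIter, List.sum_ofFn]
    · intro v0 _ hv
      refine sum_eq_zero fun v _ => sum_eq_zero fun h _ => if_neg fun hh => hv ?_
      exact funext fun j => Fin.ext (by simpa using hh.1 j)
    · simp
  | succ M ih =>
    rw [boundedSum_succ _ _ _ _ _ hle, rowIter]
    refine Eq.trans ?_ ((sum_row_eq_rowOp (w 0) B N bottom 0 hB fun r cs =>
      (right 0).indicator (fun _ => boundedSum B M N (fun i _ => vertexWeight (w i.succ))
        (fun j => cs.getD j 0) (Fin.tail right)) r).trans (rowOp_congr _ _ _ fun r cs h1 h2 => ?_))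
    · refine sum_congr rfl fun c _ => sum_congr rfl fun g _ => ?_
      simp only [List.getD_eq_getElem?_getD, List.getElem?_ofFn, Fin.is_lt, dif_pos,
        Option.getD_some]
      rfl
    · rw [List.length_ofFn] at h1
      rw [List.sum_ofFn] at h2
      have hcs : List.ofFn (fun j : Fin N => cs.getD j 0) = cs := by
        refine List.ext_getElem (by simp [h1]) fun i hi hi' => ?_
        simp [List.getD_eq_getElem?_getD, hi']
      have hsum : ∑ j : Fin N, cs.getD j 0 < B := by
        rw [← List.sum_ofFn, hcs]
        omega
      rw [ih (fun i => w i.succ) _ hsum _ fun j =>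
        (single_le_sum (fun _ _ => Nat.zero_le _) (mem_univ j)).trans_lt hsum, hcs]
      rfl

theorem partitionFunction_eq_shrinkIter (n : ℕ) (w : Fin n → ℕ → ℕ → R)
    (hw : ∀ i, w i 0 0 = 1) (bottom : Fin n → ℕ) (right : Fin n → Set ℕ) :
    partitionFunction n n (fun i _ => vertexWeight (w i)) bottom (fun _ => 0) (fun _ => 0) right =
      shrinkIter n w right (List.ofFn bottom) := by
  rw [← rowIter_eq_shrinkIter n w hw _ _ (by simp)]
  exact boundedSum_eq_rowIter ((∑ j, bottom j) + (∑ i : Fin n, 0) + 1) n n w bottom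
    (by simp) right

end Lattice

/-! ### Gelfand–Tsetlin sums -/

section GelfandTsetlin

/-- The list `l_{n-1} - t, l_{n-2} - l_{n-1}, …, l_0 - l_1`. -/
def diffList : (n : ℕ) → (Fin n → ℕ) → ℕ → List ℕ
  | 0, _, _ => []
  | n + 1, l, t => (l (Fin.last n) - t) :: diffList n (Fin.init l) (l (Fin.last n))

theorem sum_piFinset_snoc {M : Type*} [AddCommMonoid M] {n : ℕ} (s : Fin (n + 1) → Finset ℕ)
    (F : (Fin (n + 1) → ℕ) → M) :
    ∑ m ∈ Fintype.piFinset s, F m =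
      ∑ k ∈ s (Fin.last n), ∑ m ∈ Fintype.piFinset (Fin.init s), F (Fin.snoc m k) := by
  rw [← sum_product']
  refine sum_bij' (fun m _ => (m (Fin.last n), Fin.init m)) (fun p _ => Fin.snoc p.2 p.1)
    ?_ ?_ ?_ ?_ ?_
  · intro m hm
    rw [Fin.mem_piFinset_iff_last_init] at hm
    exact mem_product.2 hm
  · intro p hp
    rw [Fin.mem_piFinset_iff_last_init]
    simpa using hp
  · intro m hm
    simp
  · intro p hp
    simp
  · intro m hm
    simp

variable {R : Type*} [CommRing R] [Algebra Kq R]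

/-- A column of `l_i - l_{i+1}` particles sends `l_i - m_i` to the right and `m_i - l_{i+1}` up.
With the `l_{i+1} - m_{i+1}` arriving from the left, its top label is `m_i - m_{i+1}`. The parameter
`t` stands for the entry of `m` after the last one and makes the induction possible. -/
theorem sum_interlacing_eq_rowOp (x : R) (n : ℕ) (l : Fin (n + 1) → ℕ)
    (hl : ∀ i : Fin n, l i.succ ≤ l i.castSucc) (t : ℕ) (ht : t ≤ l (Fin.last n))
    (f : List ℕ → R) :
    ∑ m ∈ Fintype.piFinset (fun i : Fin n => Icc (l i.succ) (l i.castSucc)),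
        (∏ i : Fin n, algebraMap Kq R (qBinom (l i.castSucc - l i.succ) (l i.castSucc - m i)) *
          x ^ (l i.castSucc - m i)) * f (diffList n m t) =
      rowOp (whitWeight x) (diffList n (Fin.init l) (l (Fin.last n))) (l (Fin.last n) - t)
        (fun _ cs => f cs) := by
  induction n generalizing t f with
  | zero => simp [diffList, rowOp]
  | succ n ih =>
    have hlast := hl (Fin.last n)
    have hE : l (Fin.last n).succ = l (Fin.last (n + 1)) := rfl
    rw [hE] at hlast
    rw [sum_piFinset_snoc, diffList, rowOp]
    refine sum_bij' (fun k _ => (l (Fin.last n).castSucc - k, k - l (Fin.last (n + 1))))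
      (fun p _ => p.2 + l (Fin.last (n + 1))) ?_ ?_ ?_ ?_ ?_
    · intro k hk
      simp only [mem_Icc, hE] at hk
      simp only [HasAntidiagonal.mem_antidiagonal, Fin.init]
      omega
    · intro p hp
      simp only [HasAntidiagonal.mem_antidiagonal, Fin.init] at hp
      simp only [mem_Icc, hE]
      omega
    · intro k hk
      simp only [mem_Icc, hE] at hk
      simp only
      omega
    · intro p hp
      simp only [HasAntidiagonal.mem_antidiagonal, Fin.init] at hp
      ext
      all_goals simp
      all_goals omega
    · intro k hk
      simp only [mem_Icc, hE] at hk
      have h := ih (Fin.init l) (fun i => hl i.castSucc) k hk.2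
        (fun cs => f ((k - l (Fin.last (n + 1)) + (l (Fin.last (n + 1)) - t)) :: cs))
      refine Eq.trans ?_ (congrArg _ h)
      rw [mul_sum]
      refine sum_congr rfl fun m _ => ?_
      have e1 : l (Fin.last n).castSucc - l (Fin.last (n + 1)) =
        (l (Fin.last n).castSucc - k) + (k - l (Fin.last (n + 1))) := by omega
      have e2 : k - l (Fin.last (n + 1)) + (l (Fin.last (n + 1)) - t) = k - t := by omega
      rw [Fin.prod_univ_castSucc, hE, Fin.snoc_last, e1, qBinom_left, diffList,
        Fin.snoc_last, Fin.init_snoc, e2, whitWeight]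
      simp only [Fin.snoc_castSucc, Fin.init, Fin.castSucc_succ]
      ring

/-- Each branching step is one row. Evaluation at arbitrary points `y` absorbs the renaming of
variables in the recursion. -/
theorem aeval_gelfandTsetlinSum (n : ℕ) (l : Fin n → ℕ) (hl : ∀ i j, i ≤ j → l j ≤ l i)
    (y : Fin n → R) :
    MvPolynomial.aeval y (gelfandTsetlinSum n l) =
      shrinkIter n (fun i => whitWeight (y i.rev)) (fun _ => Set.univ) (diffList n l 0) := by
  induction n with
  | zero => simp [gelfandTsetlinSum, shrinkIter]
  | succ n ih =>
    have h := sum_interlacing_eq_rowOp (y (Fin.last n)) n l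
      (fun i => hl _ _ (Fin.castSucc_lt_succ).le) 0 (Nat.zero_le _)
      (shrinkIter n (fun i => whitWeight (y i.rev.castSucc)) (fun _ => Set.univ))
    rw [Nat.sub_zero] at h
    simp only [shrinkIter, diffList, shrinkOp, Fin.rev_zero, whitWeight_zero_right, Nat.sub_zero,
      Set.indicator_univ]
    refine Eq.trans ?_ (congrArg (y (Fin.last n) ^ l (Fin.last n) * ·) (h.trans ?_))
    · rw [gelfandTsetlinSum, map_sum, mul_sum]
      refine sum_congr rfl fun m hm => ?_
      rw [Fintype.mem_piFinset] at hm
      simp only [mem_Icc] at hm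
      have hm' : ∀ i j, i ≤ j → m j ≤ m i := by
        intro i j hij
        rcases hij.eq_or_lt with rfl | hij
        · rfl
        · exact (hm j).2.trans ((hl _ _ (Fin.succ_le_castSucc_iff.2 hij)).trans (hm i).1)
      -- The summand `l (Fin.last n)` is the contribution of the emptied first column.
      have he : (∑ i, l i) - ∑ i, m i = l (Fin.last n) + ∑ i : Fin n, (l i.castSucc - m i) := by
        rw [sum_tsub_distrib _ fun i _ => (hm i).2, Fin.sum_univ_castSucc]
        have := sum_le_sum fun i (_ : i ∈ univ) => (hm i).2
        omega
      have hih := ih m hm' (y ∘ Fin.castSucc)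
      simp only [Function.comp_apply] at hih
      rw [map_mul, map_mul, map_pow, MvPolynomial.aeval_rename, hih, MvPolynomial.aeval_X, he,
        MvPolynomial.aeval_C, pow_add, prod_mul_distrib, map_prod, prod_pow_eq_pow_sum]
      ring
    · simp only [Fin.tail_def, Fin.rev_succ]

end GelfandTsetlin

/-! ### Positivity -/

section Positivity

/-- The rational functions that are polynomials in `q` with natural coefficients. -/
def natPolys : Subsemiring Kq :=
  ((algebraMap (Polynomial ℚ) Kq).comp
    (Polynomial.mapRingHom (Nat.castRingHom ℚ))).rangeS

theorem q_mem_natPolys : q ∈ natPolys :=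
  ⟨Polynomial.X, by simp [q, RatFunc.algebraMap_X]⟩

theorem gaussBinom_mem_natPolys (d e : ℕ) : gaussBinom d e ∈ natPolys := by
  induction d generalizing e with
  | zero => rw [gaussBinom_zero_left]; exact one_mem _
  | succ d ihd =>
    induction e with
    | zero => rw [gaussBinom_zero_right]; exact one_mem _
    | succ e ihe =>
      rw [gaussBinom_succ_succ]
      exact add_mem ihe (mul_mem (pow_mem q_mem_natPolys _) (ihd _))

theorem rowOp_mem {R : Type*} [CommRing R] (P : Subsemiring R) (w : ℕ → ℕ → R)
    (hw : ∀ d e, w d e ∈ P) (as : List ℕ) (b : ℕ) (f : ℕ → List ℕ → R)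
    (hf : ∀ r cs, f r cs ∈ P) : rowOp w as b f ∈ P := by
  induction as generalizing b f with
  | nil => exact hf _ _
  | cons a as ih => exact sum_mem fun p _ => mul_mem (hw _ _) (ih _ _ fun r cs => hf _ _)

theorem shrinkIter_mem {R : Type*} [CommRing R] (P : Subsemiring R) (n : ℕ)
    (w : Fin n → ℕ → ℕ → R) (hw : ∀ i d e, w i d e ∈ P) (S : Fin n → Set ℕ) (as : List ℕ) :
    shrinkIter n w S as ∈ P := by
  induction n generalizing as with
  | zero => exact one_mem _
  | succ n ih =>
    rcases as with _ | ⟨a, as⟩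
    · exact zero_mem _
    · refine mul_mem (hw _ _ _) (rowOp_mem P _ (hw 0) _ _ _ fun r cs => ?_)
      by_cases h : r ∈ S 0
      · rw [Set.indicator_of_mem h]
        exact ih _ (fun i => hw i.succ) _ _
      · rw [Set.indicator_of_notMem h]
        exact zero_mem _

end Positivity

/-! ### Young diagrams and column multiplicities -/

section Diagrams

theorem colMult_eq (μ : YoungDiagram) (i : ℕ) :
    colMult μ (i + 1) = μ.rowLen i - μ.rowLen (i + 1) := by
  -- A column has size `i + 1` exactly when it meets row `i` but not row `i + 1`.
  have h : (range (μ.rowLen 0)).filter (fun j => μ.colLen j = i + 1) =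
      Ico (μ.rowLen (i + 1)) (μ.rowLen i) := by
    ext j
    rw [mem_filter, mem_range, mem_Ico, ← YoungDiagram.mem_iff_lt_rowLen,
      ← YoungDiagram.mem_iff_lt_rowLen, ← not_lt, ← YoungDiagram.mem_iff_lt_rowLen,
      YoungDiagram.mem_iff_lt_colLen, YoungDiagram.mem_iff_lt_colLen,
      YoungDiagram.mem_iff_lt_colLen]
    omega
  rw [← Nat.card_Ico, ← h, ← Nat.count_eq_card_filter_range, colMult, YoungDiagram.rowLens,
    YoungDiagram.colLen_transpose, List.count, List.countP_map, Nat.count]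
  refine List.countP_congr fun j _ => ?_
  simp [YoungDiagram.rowLen_transpose]

theorem rowLen_eq_zero {μ : YoungDiagram} {n : ℕ} (h : μ.colLen 0 ≤ n) : μ.rowLen n = 0 := by
  by_contra h0
  have := YoungDiagram.mem_iff_lt_colLen.1
    (YoungDiagram.mem_iff_lt_rowLen.2 (Nat.pos_of_ne_zero h0))
  omega

theorem ofFn_colMult_eq_diffList (n : ℕ) (μ : YoungDiagram) :
    List.ofFn (fun j : Fin n => colMult μ (n - (j : ℕ))) =
      diffList n (fun i => μ.rowLen i) (μ.rowLen n) := by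
  induction n with
  | zero => rfl
  | succ n ih =>
    rw [List.ofFn_succ, diffList]
    refine congrArg₂ _ (colMult_eq μ n) (Eq.trans ?_ ih)
    simp

/-- The column multiplicities of a Young diagram with at most `n` rows. -/
def colMults (n : ℕ) (μ : YoungDiagram) (i : Fin n) : ℕ := colMult μ (i + 1)

theorem reverse_ofFn_colMults (n : ℕ) (μ : YoungDiagram) :
    (List.ofFn (colMults n μ)).reverse = List.ofFn (fun j : Fin n => colMult μ (n - (j : ℕ))) := by
  refine List.ext_getElem (by simp) fun i h1 h2 => ?_
  rw [List.length_ofFn] at h2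
  simp only [List.getElem_reverse, List.getElem_ofFn, colMults, List.length_ofFn]
  congr 1
  omega

theorem bijOn_colMults (n : ℕ) :
    Set.BijOn (colMults n) {μ | μ.colLen 0 ≤ n} Set.univ := by
  refine ⟨fun _ _ => Set.mem_univ _, ?_, ?_⟩
  · intro μ hμ ν hν h
    -- Row lengths are recovered from the bottom row upwards, starting from the empty row `n`.
    have hrow : ∀ k i, i + k = n → μ.rowLen i = ν.rowLen i := by
      intro k
      induction k with
      | zero =>
        rintro i rfl
        exact (rowLen_eq_zero hμ).trans (rowLen_eq_zero hν).symm
      | succ k ih =>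
        intro i hi
        have h1 := congrFun h ⟨i, by omega⟩
        simp only [colMults, colMult_eq] at h1
        have h2 := ih (i + 1) (by omega)
        have h3 := μ.rowLen_anti i (i + 1) (by omega)
        have h4 := ν.rowLen_anti i (i + 1) (by omega)
        omega
    ext ⟨i, j⟩
    rw [YoungDiagram.mem_cells, YoungDiagram.mem_cells, YoungDiagram.mem_iff_lt_rowLen,
      YoungDiagram.mem_iff_lt_rowLen]
    rcases le_total i n with hi | hi
    · rw [hrow (n - i) i (by omega)]
    · rw [rowLen_eq_zero (le_trans hμ hi), rowLen_eq_zero (le_trans hν hi)]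
  · intro m _
    -- Row `i` meets exactly the columns of size greater than `i`.
    let r : ℕ → ℕ := fun i => ∑ k ∈ univ.filter (fun k : Fin n => i ≤ (k : ℕ)), m k
    have hr : Antitone r := fun i j hij => sum_le_sum_of_subset fun k hk => by
      simp only [mem_filter, mem_univ, true_and] at hk ⊢
      omega
    have hrn : ∀ i, n ≤ i → r i = 0 := fun i hi => sum_eq_zero fun k hk => by
      simp only [mem_filter, mem_univ, true_and] at hk
      omega
    let μ : YoungDiagram :=
      { cells := (range n ×ˢ range (r 0)).filter fun p => p.2 < r p.1
        isLowerSet := by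
          rintro ⟨i, j⟩ ⟨i', j'⟩ ⟨h1, h2⟩ h
          simp only [coe_filter, mem_product, mem_range, Set.mem_ofPred_eq] at h h1 h2 ⊢
          have := hr h1
          omega }
    have hμ : ∀ i j, (i, j) ∈ μ ↔ j < r i := by
      intro i j
      rw [← YoungDiagram.mem_cells]
      simp only [μ, mem_filter, mem_product, mem_range]
      refine ⟨fun h => h.2, fun h => ⟨⟨?_, h.trans_le (hr (Nat.zero_le i))⟩, h⟩⟩
      by_contra hi
      rw [hrn i (by omega)] at h
      omega
    have hrow : ∀ i, μ.rowLen i = r i := fun i => by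
      refine eq_of_forall_lt_iff fun j => ?_
      rw [← YoungDiagram.mem_iff_lt_rowLen, hμ]
    refine ⟨μ, ?_, ?_⟩
    · rw [Set.mem_ofPred_eq]
      by_contra h
      have h1 := YoungDiagram.mem_iff_lt_colLen.2 (not_le.1 h)
      rw [hμ, hrn n le_rfl] at h1
      omega
    · ext i
      rw [colMults, colMult_eq, hrow, hrow]
      have : r i = m i + r (i + 1) := by
        have hs : (univ.filter fun k : Fin n => (i : ℕ) ≤ k) =
            insert i (univ.filter fun k : Fin n => (i : ℕ) + 1 ≤ k) := by
          ext k
          simp only [mem_filter, mem_univ, true_and, mem_insert, Fin.ext_iff]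
          omega
        simp only [r]
        rw [hs, sum_insert (by simp)]
      omega

end Diagrams

/-! ### Translation of the three partition functions and conclusion -/

theorem inhomWeight_eq {n : ℕ} (x : MvPolynomial (Fin n) Kq) :
    inhomWeight x = vertexWeight (inhWeight x) := by
  funext a b c d
  rw [inhomWeight, vertexWeight]
  split_ifs with h
  · have ha : a = d + (c - b) := by omega
    rw [inhWeight, whitWeight, gaussBinom, ← ha, MvPolynomial.algebraMap_eq]
    ring
  · rfl

theorem transitionWeight_eq : transitionWeight = vertexWeight (whitWeight (1 : Kq)) := by
  funext a b c d
  rw [transitionWeight, vertexWeight]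
  split_ifs with h
  · have ha : a = d + (c - b) := by omega
    simp [whitWeight, gaussBinom, ← ha]
  · rfl

theorem transitionCoeff_eq (n : ℕ) (lam mu : YoungDiagram) :
    transitionCoeff n lam mu = shrinkIter n (fun _ => whitWeight 1)
      (fun i => {colMults n mu i}) (List.ofFn fun j : Fin n => colMult lam (n - (j : ℕ))) := by
  rw [transitionCoeff, transitionWeight_eq]
  exact partitionFunction_eq_shrinkIter n (fun _ => whitWeight 1)
    (fun _ => by simp [whitWeight_zero_right]) _ _

theorem inhomQWhittaker_eq (n : ℕ) (mu : YoungDiagram) (h : mu.colLen 0 ≤ n) :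
    inhomQWhittaker n mu = shrinkIter n (fun i => inhWeight (MvPolynomial.X i.rev))
      (fun _ => Set.univ) (List.ofFn (colMults n mu)).reverse := by
  rw [reverse_ofFn_colMults, ← partitionFunction_eq_shrinkIter n
    (fun i => inhWeight (MvPolynomial.X i.rev)) (fun _ => by simp [inhWeight_zero_right])]
  simp only [inhomQWhittaker, inhomWeight_eq]
  rw [max_eq_left h]

theorem qWhittaker_eq (n : ℕ) (lam : YoungDiagram) (h : lam.colLen 0 ≤ n) :
    qWhittaker n lam = shrinkIter n (fun i => whitWeight (MvPolynomial.X i.rev))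
      (fun _ => Set.univ) (List.ofFn fun j : Fin n => colMult lam (n - (j : ℕ))) := by
  rw [qWhittaker, if_pos h, ofFn_colMult_eq_diffList, rowLen_eq_zero h,
    ← aeval_gelfandTsetlinSum n _ fun i j hij => lam.rowLen_anti _ _ hij]
  simp

theorem map_whitWeight_one {R : Type*} [CommRing R] [Algebra Kq R] (d e : ℕ) :
    algebraMap Kq R (whitWeight 1 d e) = whitWeight 1 d e := by
  simp [whitWeight]

/-- The coefficient vanishes unless both diagrams have the same number of columns. -/
theorem transitionCoeff_eq_zero (n : ℕ) (lam mu : YoungDiagram)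
    (h : ∑ i, colMults n mu i ≠ ∑ j : Fin n, colMult lam (n - (j : ℕ))) :
    transitionCoeff n lam mu = 0 := by
  rw [transitionCoeff_eq]
  exact shrinkIter_eq_zero n _ _ _ (by simp) (by rwa [List.sum_ofFn])

theorem finite_transitionCoeff_ne_zero (n : ℕ) (lam : YoungDiagram) :
    {mu : YoungDiagram | mu.colLen 0 ≤ n ∧ transitionCoeff n lam mu ≠ 0}.Finite := by
  refine Set.Finite.of_finite_image (f := colMults n) (Set.Finite.subset
    (Set.Finite.pi' (t := fun _ : Fin n => Set.Iic (∑ j : Fin n, colMult lam (n - (j : ℕ))))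
      fun _ => Set.finite_Iic _) ?_) ((bijOn_colMults n).injOn.mono fun mu h => h.1)
  rintro _ ⟨mu, ⟨-, h⟩, rfl⟩ i
  rw [Set.mem_Iic, ← not_not.1 (mt (transitionCoeff_eq_zero n lam mu) h)]
  exact single_le_sum (f := colMults n mu) (fun _ _ => Nat.zero_le _) (mem_univ i)

theorem qWhittaker_eq_finsum (n : ℕ) (lam : YoungDiagram) (hlam : lam.colLen 0 ≤ n) :
    qWhittaker n lam = ∑ᶠ (mu : YoungDiagram) (_ : mu.colLen 0 ≤ n),
      MvPolynomial.C (transitionCoeff n lam mu) * inhomQWhittaker n mu := by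
  let as := List.ofFn fun j : Fin n => colMult lam (n - (j : ℕ))
  let G : (Fin n → ℕ) → MvPolynomial (Fin n) Kq := fun m =>
    shrinkIter n (fun _ => whitWeight 1) (fun i => {m i}) as *
      shrinkIter n (fun i => inhWeight (MvPolynomial.X i.rev)) (fun _ => Set.univ)
        (List.ofFn m).reverse
  have has : as.length = n := List.length_ofFn
  have h1 : qWhittaker n lam = ∑ m : Fin n → Fin (as.sum + 1), G fun i => m i := by
    rw [qWhittaker_eq n lam hlam, ← expansionOp_shrinkIter n (fun i => MvPolynomial.X i.rev) as has,
      expansionOp_eq_sum (as.sum + 1) n as has (Nat.lt_succ_self _)]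
  have h2 : ∑ᶠ mu ∈ {mu : YoungDiagram | mu.colLen 0 ≤ n},
      MvPolynomial.C (transitionCoeff n lam mu) * inhomQWhittaker n mu = ∑ᶠ m ∈ Set.univ, G m := by
    refine finsum_mem_eq_of_bijOn (colMults n) (bijOn_colMults n) fun mu hmu => ?_
    rw [transitionCoeff_eq, inhomQWhittaker_eq n mu hmu, ← MvPolynomial.algebraMap_eq,
      map_shrinkIter]
    simp only [map_whitWeight_one, G, as]
  let ι : (Fin n → Fin (as.sum + 1)) ↪ (Fin n → ℕ) :=
    ⟨fun m i => m i, fun m m' h => funext fun i => Fin.ext (congrFun h i)⟩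
  refine h1.trans (Eq.trans ?_ h2.symm)
  rw [finsum_mem_univ, finsum_eq_sum_of_support_subset (s := univ.map ι), sum_map]
  · rfl
  -- By conservation, labels that contribute sum to `as.sum`, so each is below the cutoff `as.sum +
  -- 1`.
  · intro m hm
    have hs : ∑ i, m i = as.sum := by
      by_contra h
      exact hm (by simp only [G, shrinkIter_eq_zero n _ m as has h, zero_mul])
    rw [mem_coe, mem_map]
    refine ⟨fun i => ⟨m i, ?_⟩, mem_univ _, rfl⟩
    rw [← hs, Nat.lt_succ_iff]
    exact single_le_sum (f := m) (fun _ _ => Nat.zero_le _) (mem_univ i)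

theorem transitionCoeff_mem_natPolys (n : ℕ) (lam mu : YoungDiagram) :
    transitionCoeff n lam mu ∈ natPolys := by
  rw [transitionCoeff_eq]
  refine shrinkIter_mem _ _ _ (fun _ d e => ?_) _ _
  simpa [whitWeight] using gaussBinom_mem_natPolys d e

end QW

end

theorem mainTheorem3 (n : ℕ) (lam : YoungDiagram) (hlam : lam.colLen 0 ≤ n) :
    {mu : YoungDiagram | mu.colLen 0 ≤ n ∧ QW.transitionCoeff n lam mu ≠ 0}.Finite ∧
    QW.qWhittaker n lam =
      ∑ᶠ (mu : YoungDiagram) (_ : mu.colLen 0 ≤ n),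
        MvPolynomial.C (QW.transitionCoeff n lam mu) * QW.inhomQWhittaker n mu ∧
    ∀ mu : YoungDiagram, mu.colLen 0 ≤ n →
      ∃ p : Polynomial ℕ,
        QW.transitionCoeff n lam mu =
          algebraMap (Polynomial ℚ) QW.Kq (p.map (Nat.castRingHom ℚ)) := by
  refine ⟨QW.finite_transitionCoeff_ne_zero n lam, QW.qWhittaker_eq_finsum n lam hlam,
    fun mu _ => ?_⟩
  obtain ⟨p, hp⟩ := QW.transitionCoeff_mem_natPolys n lam mu
  exact ⟨p, hp.symm⟩
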